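/- Let $(M,g)$ be a real-analytic Riemannian manifold of dimension $n$ (without boundary), with gradient $\nabla$ and Laplace--Beltrami operator $\Delta=\operatorname{div}\nabla$. A function $f:M\to\mathbb R$ is called an \emph{equilibrium function} if it is real-analytic and both $|\nabla f|^2$ and $\Delta f$ are constant on every connected component of every fibre $f^{-1}(c)$, $c\in f(M)$. For an open set $U\subseteq M$, a function $f$ is called \emph{isoparametric on $U$} if $f$ is smooth on $U$ and there are smooth functions $F,G$ on $f(U)$ with $|\nabla f|^2=F(f)$ and $\Delta f=G(f)$ on $U$. Let $C(f)=\{x\in M: df_x=0\}$ denote the critical set of $f$. (1) Every equilibrium function is locally isoparametric: if $f$ is an equilibrium function on $M$, then $f$ is isoparametric on each connected component of $M\setminus C(f)$. (2) This need not hold globally: on the Euclidean plane the function $f(x,y)=\cos\sqrt{x^2+y^2}$ is an equilibrium function, but there is no function $G:\mathbb R\to\mathbb R$ with $\Delta f=G(f)$ on all of $\mathbb R^2$; in particular $f$ is not isoparametric on $\mathbb R^2$. -/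

import Mathlib

open Bundle
open scoped Manifold ContDiff

noncomputable section

namespace Isopar

section Defs

variable {n : ℕ} {M : Type*} [TopologicalSpace M] [ChartedSpace (EuclideanSpace ℝ (Fin n)) M]

/-- The critical set `C(f)`: the points at which the differential of `f` (equivalently its
gradient) vanishes. -/
def criticalSet (f : M → ℝ) : Set M :=
  {x | mfderiv (𝓡 n) 𝓘(ℝ, ℝ) f x = 0}

/-- The coordinate vector field `∂ᵢ` of the preferred chart at `x`, at the point with
coordinates `y`. -/
def coordVector (x : M) (i : Fin n) (y : EuclideanSpace ℝ (Fin n)) :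
    TangentSpace (𝓡 n) ((extChartAt (𝓡 n) x).symm y) :=
  mfderiv 𝓘(ℝ, EuclideanSpace ℝ (Fin n)) (𝓡 n) (extChartAt (𝓡 n) x).symm y
    (EuclideanSpace.single i (1 : ℝ))

/-- The coordinate expression `(X¹, …, Xⁿ)` of a vector field in the preferred chart at `x`. -/
def coordField (X : ∀ z : M, TangentSpace (𝓡 n) z) (x : M)
    (y : EuclideanSpace ℝ (Fin n)) : EuclideanSpace ℝ (Fin n) :=
  mfderiv (𝓡 n) 𝓘(ℝ, EuclideanSpace ℝ (Fin n)) (extChartAt (𝓡 n) x)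
    ((extChartAt (𝓡 n) x).symm y) (X ((extChartAt (𝓡 n) x).symm y))

variable [RiemannianBundle (fun x : M ↦ TangentSpace (𝓡 n) x)]

/-- The Riemannian gradient: the vector `∇f(x)` with `⟪∇f(x), v⟫ = df_x(v)` for all `v`. -/
def riemGradient (f : M → ℝ) (x : M) : TangentSpace (𝓡 n) x :=
  haveI : FiniteDimensional ℝ (TangentSpace (𝓡 n) x) :=
    inferInstanceAs (FiniteDimensional ℝ (EuclideanSpace ℝ (Fin n)))
  haveI : CompleteSpace (TangentSpace (𝓡 n) x) := FiniteDimensional.complete ℝ _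
  (InnerProductSpace.toDual ℝ (TangentSpace (𝓡 n) x)).symm
    (mfderiv (𝓡 n) 𝓘(ℝ, ℝ) f x : TangentSpace (𝓡 n) x →L[ℝ] ℝ)

/-- The squared norm of the gradient, `|∇f|² = ⟪∇f, ∇f⟫`. -/
def gradSq (f : M → ℝ) (x : M) : ℝ :=
  inner ℝ (riemGradient (n := n) f x) (riemGradient (n := n) f x)

/-- The matrix `gᵢⱼ = ⟪∂ᵢ, ∂ⱼ⟫` of the metric in the preferred chart at `x`. -/
def metricMatrix (x : M) (y : EuclideanSpace ℝ (Fin n)) : Matrix (Fin n) (Fin n) ℝ :=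
  Matrix.of fun i j ↦ inner ℝ (coordVector x i y) (coordVector x j y)

/-- The Riemannian volume density `√(det g)` in the preferred chart at `x`. -/
def volDensity (x : M) (y : EuclideanSpace ℝ (Fin n)) : ℝ :=
  √((metricMatrix x y).det)

/-- The Riemannian divergence `div X = (1 / √(det g)) ∑ᵢ ∂ᵢ (√(det g) Xⁱ)`, computed at `x` in the
preferred chart at `x`. -/
def divergence (X : ∀ z : M, TangentSpace (𝓡 n) z) (x : M) : ℝ :=
  (volDensity (n := n) x (extChartAt (𝓡 n) x x))⁻¹ *
    ∑ i : Fin n,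
      fderiv ℝ (fun y ↦ volDensity x y * coordField X x y i) (extChartAt (𝓡 n) x x)
        (EuclideanSpace.single i (1 : ℝ))

/-- The Laplace–Beltrami operator `Δf = div ∇f`. -/
def laplacian (f : M → ℝ) (x : M) : ℝ :=
  divergence (n := n) (riemGradient f) x

/-- An equilibrium function: a real-analytic function such that `|∇f|²` and `Δf` are constant on
every leaf of the partition induced by `f`, the leaves being the connected components of the
fibres of `f`. -/
def IsEquilibrium (f : M → ℝ) : Prop :=
  ContMDiff (𝓡 n) 𝓘(ℝ, ℝ) ω f ∧
    ∀ x : M, ∀ y ∈ connectedComponentIn (f ⁻¹' {f x}) x,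
      gradSq (n := n) f y = gradSq (n := n) f x ∧
        laplacian (n := n) f y = laplacian (n := n) f x

/-- `f` is isoparametric on the open set `U`: it is smooth there, and `|∇f|² = F(f)` and
`Δf = G(f)` on `U` for smooth functions `F` and `G` on the set of values `f(U)`. -/
def IsIsoparametricOn (f : M → ℝ) (U : Set M) : Prop :=
  ContMDiffOn (𝓡 n) 𝓘(ℝ, ℝ) ∞ f U ∧
    ∃ F G : ℝ → ℝ, ContDiffOn ℝ ∞ F (f '' U) ∧ ContDiffOn ℝ ∞ G (f '' U) ∧
      ∀ x ∈ U, gradSq (n := n) f x = F (f x) ∧ laplacian (n := n) f x = G (f x)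

end Defs

/-- The function `cos √(x² + y²)` on the plane. -/
def cosRadius (p : EuclideanSpace ℝ (Fin 2)) : ℝ :=
  Real.cos √(p 0 ^ 2 + p 1 ^ 2)

end Isopar

end

/-! Near a regular point the implicit function theorem makes `f` a coordinate, and the fibres of `f`
become connected slices. A function `h` that is constant on the components of fibres is therefore,
near that point, a function of `f`. It is an analytic one when `h` is analytic, since it can be read
off along an analytic section of `f` (`exists_analyticAt_of_constant_on_leaves`).

The global difficulty is that a component `U` of the regular set may meet one fibre in several
leaves. Analyticity settles this: along chains of neighbourhoods in the connected set `U` the local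
functions of `f` agree near a common value, because `f` is open there. They then agree on
overlapping intervals by the identity theorem, so two points of `U` with equal `f` have equal `h`
(`exists_analyticOnNhd_of_locally`).

It remains to know that `|∇f|²` and `Δf` are analytic. In a chart the gradient is given by Cramer's
rule. The divergence is defined at each point in that point's own chart, so its regularity rests on
independence of the chart, which follows from the Piola identity.

For the example, `f = c(r²)` with `c` entire, so `|∇f|²` and `Δf` depend on `r` only, and `r` is
constant on every leaf because `cos` is constant on no nontrivial interval. But `f = 1` both at the
origin and on the circle `r = 2π`, where `Δf` is `-2` and `-1` respectively. -/

noncomputable section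

namespace Isopar

open Filter Topology Set

/-! ### Fibres and sections of a function near a regular point -/

section Fibres

variable {E : Type*} [NormedAddCommGroup E] [NormedSpace ℝ E] [CompleteSpace E]

/-- Near a point where the derivative of `g` does not vanish, any two nearby points on the same
fibre of `g` lie on a preconnected part of that fibre inside a given neighbourhood. -/
theorem eventually_exists_isPreconnected_fibre {g : E → ℝ} {g' : E →L[ℝ] ℝ} {a : E} {O : Set E}
    (hg : HasStrictFDerivAt g g' a) (hg' : g' ≠ 0) (hO : O ∈ 𝓝 a) :
    ∃ W ∈ 𝓝 a, ∀ y ∈ W, ∀ z ∈ W, g y = g z →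
      ∃ C ⊆ O, IsPreconnected C ∧ y ∈ C ∧ z ∈ C ∧ C ⊆ g ⁻¹' {g y} := by
  have hsurj : g'.range = ⊤ := LinearMap.range_eq_top.2 <|
    LinearMap.surjective (fun h ↦ hg' (ContinuousLinearMap.coe_inj.1 h))
  -- A nonzero functional is onto `ℝ`, so `g` is the first component of a local product coordinate
  -- system `Φ`.
  set Φ := hg.implicitToOpenPartialHomeomorph g g' hsurj with hΦ
  have haS : a ∈ Φ.source := hg.mem_implicitToOpenPartialHomeomorph_source hsurj
  have haT : Φ a ∈ Φ.target := Φ.map_source haS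
  have hN : Φ.target ∩ Φ.symm ⁻¹' O ∈ 𝓝 (Φ a) := by
    refine inter_mem (Φ.open_target.mem_nhds haT) ?_
    exact (Φ.tendsto_symm haS) hO
  obtain ⟨r, hr, hball⟩ := Metric.mem_nhds_iff.1 hN
  refine ⟨Φ.source ∩ Φ ⁻¹' Metric.ball (Φ a) r,
    inter_mem (Φ.open_source.mem_nhds haS)
      ((Φ.continuousAt haS) (Metric.ball_mem_nhds _ hr)), ?_⟩
  rintro y ⟨hyS, hy⟩ z ⟨hzS, hz⟩ hyz
  rw [mem_preimage, ← ball_prod_same] at hy hz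
  rw [← ball_prod_same] at hball
  have hfst : ∀ x, (Φ x).1 = g x := fun x ↦ hg.implicitToOpenPartialHomeomorph_fst hsurj x
  have hsub : ({g y} ×ˢ Metric.ball (Φ a).2 r : Set _) ⊆
      Metric.ball (Φ a).1 r ×ˢ Metric.ball (Φ a).2 r := by
    refine prod_mono_left (singleton_subset_iff.2 ?_)
    rw [← hfst]; exact hy.1
  -- The connected piece is a slice of the product ball: first coordinate fixed, second in a convex
  -- ball.
  refine ⟨Φ.symm '' ({g y} ×ˢ Metric.ball (Φ a).2 r), ?_, ?_, ?_, ?_, ?_⟩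
  · rintro _ ⟨q, hq, rfl⟩
    exact (hball (hsub hq)).2
  · refine IsPreconnected.image ?_ _ (Φ.continuousOn_symm.mono
      fun q hq ↦ (hball (hsub hq)).1)
    exact isPreconnected_singleton.prod (convex_ball _ _).isPreconnected
  · exact ⟨Φ y, ⟨hfst y, hy.2⟩, Φ.left_inv hyS⟩
  · exact ⟨Φ z, ⟨(hfst z).trans hyz.symm, hz.2⟩, Φ.left_inv hzS⟩
  · rintro _ ⟨q, hq, rfl⟩
    have := hfst (Φ.symm q)
    rw [Φ.right_inv (hball (hsub hq)).1] at this
    exact this.symm.trans hq.1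

omit [CompleteSpace E] in
/-- A function which is analytic at `a` with non-zero derivative has a local section through `a`
that is analytic. -/
theorem exists_analyticAt_section {g : E → ℝ} {a : E} (hg : AnalyticAt ℝ g a)
    (hg' : fderiv ℝ g a ≠ 0) :
    ∃ σ : ℝ → E, AnalyticAt ℝ σ (g a) ∧ σ (g a) = a ∧ ∀ᶠ s in 𝓝 (g a), g (σ s) = s := by
  obtain ⟨v, hv⟩ : ∃ v, fderiv ℝ g a v ≠ 0 := by
    by_contra! h
    exact hg' (ContinuousLinearMap.ext h)
  -- On a line through `a` in a direction `v` with `dg(v) ≠ 0` the one-variable inverse function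
  -- theorem applies. The section is the line composed with that analytic inverse.
  set l : ℝ → E := fun t ↦ a + t • v with hl
  have hla : AnalyticAt ℝ l 0 := by fun_prop
  have hl0 : l 0 = a := by simp [hl]
  have hψ : AnalyticAt ℝ (g ∘ l) 0 := AnalyticAt.comp (by rwa [hl0]) hla
  have hld : HasDerivAt l v 0 := by
    simpa [hl] using ((hasDerivAt_id (0 : ℝ)).smul_const v).const_add a
  have hψd : deriv (g ∘ l) 0 = fderiv ℝ g a v := by
    have : HasFDerivAt g (fderiv ℝ g a) (l 0) := by
      rw [hl0]; exact hg.differentiableAt.hasFDerivAt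
    exact (this.comp_hasDerivAt 0 hld).deriv
  have hne : deriv (g ∘ l) 0 ≠ 0 := hψd ▸ hv
  have h0 : (g ∘ l) 0 = g a := by simp [hl0]
  have hs := hψ.hasStrictDerivAt
  refine ⟨l ∘ hs.localInverse _ _ _ hne, ?_, ?_, ?_⟩
  · have h1 := hψ.analyticAt_localInverse hne
    rw [h0] at h1
    refine AnalyticAt.comp ?_ h1
    fun_prop
  · have := (hs.hasStrictFDerivAt_equiv hne).localInverse_apply_image
    rw [h0] at this
    simp only [Function.comp_apply, HasStrictDerivAt.localInverse]
    rw [this, hl0]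
  · have := (hs.hasStrictFDerivAt_equiv hne).eventually_right_inverse
    rw [h0] at this
    exact this

end Fibres

/-! ### Gluing local functions of `f` by analytic continuation -/

/-- Let `h` be locally, around each point of a preconnected open set `U`, an analytic function
of `f`. If `f` is open at the points of `U`, then `h` is on `U` an analytic function of `f`. -/
theorem exists_analyticOnNhd_of_locally {X : Type*} [TopologicalSpace X] {U : Set X}
    (hUo : IsOpen U) (hU : IsPreconnected U) {f h : X → ℝ} (hf : ContinuousOn f U)
    (hopen : ∀ x ∈ U, 𝓝 (f x) ≤ map f (𝓝 x))
    (hloc : ∀ x ∈ U, ∃ F : ℝ → ℝ, AnalyticAt ℝ F (f x) ∧ ∀ᶠ y in 𝓝 x, h y = F (f y)) :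
    ∃ F : ℝ → ℝ, AnalyticOnNhd ℝ F (f '' U) ∧ ∀ x ∈ U, h x = F (f x) := by
  have hfc : ∀ x ∈ U, ContinuousAt f x := fun x hx ↦ hf.continuousAt (hUo.mem_nhds hx)
  have key : ∀ x ∈ U, ∀ y ∈ U, ∃ (I : Set ℝ) (F : ℝ → ℝ), IsOpen I ∧ IsPreconnected I ∧
      f x ∈ I ∧ f y ∈ I ∧ AnalyticOnNhd ℝ F I ∧
      (∀ᶠ z in 𝓝 x, h z = F (f z)) ∧ (∀ᶠ z in 𝓝 y, h z = F (f z)) := by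
    intro x hx y hy
    -- Being joined by one analytic `F` on an interval containing both values is symmetric,
    -- transitive and holds for nearby points, hence holds for all pairs in `U`.
    refine hU.induction₂ (fun x y ↦ ∃ (I : Set ℝ) (F : ℝ → ℝ), IsOpen I ∧ IsPreconnected I ∧
      f x ∈ I ∧ f y ∈ I ∧ AnalyticOnNhd ℝ F I ∧
      (∀ᶠ z in 𝓝 x, h z = F (f z)) ∧ (∀ᶠ z in 𝓝 y, h z = F (f z))) ?_ ?_ ?_ hx hy
    · intro x hx
      obtain ⟨F, hF, hFh⟩ := hloc x hx
      obtain ⟨r, hr, hball⟩ := Metric.mem_nhds_iff.1 hF.eventually_analyticAt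
      have h1 : ∀ᶠ y in 𝓝 x, f y ∈ Metric.ball (f x) r :=
        hfc x hx (Metric.ball_mem_nhds _ hr)
      filter_upwards [nhdsWithin_le_nhds h1, nhdsWithin_le_nhds hFh.eventually_nhds] with y hy1 hy2
      exact ⟨Metric.ball (f x) r, F, Metric.isOpen_ball, (convex_ball _ _).isPreconnected,
        Metric.mem_ball_self hr, hy1, fun s hs ↦ hball hs, hFh, hy2⟩
    · rintro x y z hx hy hz ⟨I, F, hIo, hI, hxI, hyI, hFI, hFx, hFy⟩
        ⟨J, G, hJo, hJ, hyJ, hzJ, hGJ, hGy, hGz⟩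
      -- Both `F ∘ f` and `G ∘ f` equal `h` near `y`, and `f` covers a neighbourhood of `f y`. The
      -- identity theorem then gives equality on the interval `I ∩ J`.
      have hFG : F =ᶠ[𝓝 (f y)] G := by
        refine hopen y hy (mem_map.2 ?_)
        filter_upwards [hFy, hGy] with w h1 h2
        exact h1.symm.trans h2
      have hIJ : EqOn F G (I ∩ J) :=
        AnalyticOnNhd.eqOn_of_preconnected_of_eventuallyEq (hFI.mono inter_subset_left)
          (hGJ.mono inter_subset_right)
          (hI.ordConnected.inter hJ.ordConnected).isPreconnected ⟨hyI, hyJ⟩ hFG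
      classical
      have hKI : EqOn (I.piecewise F G) F I := piecewise_eqOn _ _ _
      have hKJ : EqOn (I.piecewise F G) G J := fun s hs ↦ by
        by_cases h : s ∈ I
        · rw [piecewise_eq_of_mem _ _ _ h]; exact hIJ ⟨h, hs⟩
        · rw [piecewise_eq_of_notMem _ _ _ h]
      refine ⟨I ∪ J, I.piecewise F G, hIo.union hJo, hI.union _ hyI hyJ hJ, Or.inl hxI, Or.inr hzJ,
        ?_, ?_, ?_⟩
      · rintro s (hs | hs)
        · exact (hFI s hs).congr (hKI.eventuallyEq_of_mem (hIo.mem_nhds hs)).symm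
        · exact (hGJ s hs).congr (hKJ.eventuallyEq_of_mem (hJo.mem_nhds hs)).symm
      · filter_upwards [hFx, hfc x hx (hIo.mem_nhds hxI)] with w h1 h2
        rw [h1, hKI h2]
      · filter_upwards [hGz, hfc z hz (hJo.mem_nhds hzJ)] with w h1 h2
        rw [h1, hKJ h2]
    · rintro x y - - ⟨I, F, hIo, hI, hxI, hyI, hFI, hFx, hFy⟩
      exact ⟨I, F, hIo, hI, hyI, hxI, hFI, hFy, hFx⟩
  classical
  -- The choice of preimage is harmless: by `key`, `h` takes the same value at all points of `U`
  -- with the same `f`. The value `0` off `f '' U` plays no role, as `f` is open at the points of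
  -- `U`.
  set F : ℝ → ℝ := fun s ↦ if hs : ∃ x ∈ U, f x = s then h hs.choose else 0 with hFdef
  have hF : ∀ x ∈ U, h x = F (f x) := by
    intro x hx
    have hs : ∃ y ∈ U, f y = f x := ⟨x, hx, rfl⟩
    obtain ⟨I, G, -, -, -, -, -, h1, h2⟩ := key _ hs.choose_spec.1 x hx
    simp only [hFdef, dif_pos hs]
    rw [h1.self_of_nhds, h2.self_of_nhds, hs.choose_spec.2]
  refine ⟨F, ?_, hF⟩
  rintro _ ⟨x, hx, rfl⟩
  obtain ⟨G, hG, hGh⟩ := hloc x hx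
  refine hG.congr (hopen x hx (mem_map.2 ?_))
  filter_upwards [hGh, hUo.mem_nhds hx] with y h1 h2
  exact h1.symm.trans (hF y h2)

/-! ### Derivative of the determinant and the Piola identity -/

section Piola

variable {n : ℕ}

local notation "𝔼" => EuclideanSpace ℝ (Fin n)

theorem trace_eq_sum_single (L : 𝔼 →L[ℝ] 𝔼) :
    LinearMap.trace ℝ 𝔼 L = ∑ i, L (EuclideanSpace.single i 1) i := by
  rw [LinearMap.trace_eq_sum_inner _ (EuclideanSpace.basisFun (Fin n) ℝ)]
  simp [EuclideanSpace.inner_single_left]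

theorem det_eq_det_of_single (L : 𝔼 →L[ℝ] 𝔼) :
    L.det = (Matrix.of fun i j ↦ L (EuclideanSpace.single j 1) i).det := by
  rw [ContinuousLinearMap.det, ← LinearMap.det_toMatrix (EuclideanSpace.basisFun (Fin n) ℝ).toBasis]
  rfl

theorem contDiff_det {m : ℕ∞ω} : ContDiff ℝ m (fun L : 𝔼 →L[ℝ] 𝔼 ↦ L.det) := by
  simp only [det_eq_det_of_single, Matrix.det_apply, Matrix.of_apply]
  refine ContDiff.sum fun σ _ ↦ ContDiff.const_smul _ (contDiff_prod fun i _ ↦ ?_)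
  have : ContDiff ℝ m fun L : 𝔼 →L[ℝ] 𝔼 ↦ L (EuclideanSpace.single i 1) := by fun_prop
  exact (contDiff_euclidean.1 this) _

/-- Jacobi's formula at the identity: the derivative of the determinant is the trace. -/
theorem fderiv_det_one (H : 𝔼 →L[ℝ] 𝔼) :
    fderiv ℝ (fun L : 𝔼 →L[ℝ] 𝔼 ↦ L.det) 1 H = LinearMap.trace ℝ 𝔼 H := by
  set l : ℝ → (𝔼 →L[ℝ] 𝔼) := fun t ↦ 1 + t • H with hl
  have hl0 : l 0 = 1 := by ext1 v; simp [hl]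
  have hld : HasDerivAt l H 0 := by
    simpa [hl] using ((hasDerivAt_id (0 : ℝ)).smul_const H).const_add 1
  have h1 : HasFDerivAt (fun L : 𝔼 →L[ℝ] 𝔼 ↦ L.det)
      (fderiv ℝ (fun L : 𝔼 →L[ℝ] 𝔼 ↦ L.det) 1) (l 0) := by
    rw [hl0]
    exact ((contDiff_det (m := 1)).differentiable one_ne_zero _).hasFDerivAt
  have h2 := h1.comp_hasDerivAt (0 : ℝ) hld
  set M : Matrix (Fin n) (Fin n) ℝ := Matrix.of fun i j ↦ H (EuclideanSpace.single j 1) i with hM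
  have h3 : ((fun L : 𝔼 →L[ℝ] 𝔼 ↦ L.det) ∘ l) = fun t ↦ (1 + t • M).det := by
    funext t
    simp only [Function.comp_apply, det_eq_det_of_single]
    congr 1
    ext i j
    simp [hl, hM, Matrix.one_apply]
  rw [h3] at h2
  refine h2.unique ?_
  rw [trace_eq_sum_single]
  have ha := ((hasDerivAt_id (0 : ℝ)).const_mul M.trace).const_add 1
  -- The expansion is `det (1 + tM) = 1 + t tr M + t² q(t)` with `q` a polynomial; the last term has
  -- zero derivative at `0`.
  have hb := ((1 + (Polynomial.X : Polynomial ℝ) •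
    M.map Polynomial.C).det.divX.divX.hasDerivAt (0 : ℝ)).mul (hasDerivAt_pow 2 (0 : ℝ))
  have h4 := ha.add hb
  have h5 := h4.congr_of_eventuallyEq (f₁ := fun t : ℝ ↦ (1 + t • M).det)
    (Eventually.of_forall fun t ↦ Matrix.det_one_add_smul t M)
  simpa [hM, Matrix.trace] using h5

theorem trace_smulRight (c : 𝔼 →L[ℝ] ℝ) (b : 𝔼) :
    LinearMap.trace ℝ 𝔼 (c.smulRight b : 𝔼 →L[ℝ] 𝔼) = c b := by
  rw [trace_eq_sum_single]
  conv_rhs => rw [← (EuclideanSpace.basisFun (Fin n) ℝ).sum_repr b, map_sum]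
  simp [mul_comm]

/-- The Piola identity: if a vector density `W'` is the pull-back of `W` by `T`, then the
Euclidean divergences of `W'` and `W` differ by the factor `|det DT|`. -/
theorem trace_fderiv_of_pullback {T W W' : 𝔼 → 𝔼} {u : 𝔼} (hT : ContDiffAt ℝ 2 T u)
    (hdet : (fderiv ℝ T u).det ≠ 0) (hW : DifferentiableAt ℝ W (T u))
    (hW' : DifferentiableAt ℝ W' u)
    (h : ∀ᶠ y in 𝓝 u, fderiv ℝ T y (W' y) = |(fderiv ℝ T y).det| • W (T y)) :
    LinearMap.trace ℝ 𝔼 (fderiv ℝ W' u) =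
      |(fderiv ℝ T u).det| * LinearMap.trace ℝ 𝔼 (fderiv ℝ W (T u)) := by
  set D := fderiv ℝ T u with hD
  set A : 𝔼 →L[ℝ] 𝔼 := ((D.toContinuousLinearEquivOfDetNeZero hdet).symm : 𝔼 →L[ℝ] 𝔼) with hA
  have hAD : A ∘L D = 1 := by
    ext1 v
    exact (D.toContinuousLinearEquivOfDetNeZero hdet).symm_apply_apply v
  have hDA : D ∘L A = 1 := by
    ext1 v
    exact (D.toContinuousLinearEquivOfDetNeZero hdet).apply_symm_apply v
  have hADv : ∀ v, A (D v) = v := fun v ↦ DFunLike.congr_fun hAD v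
  have hTd : HasFDerivAt T D u := (hT.differentiableAt two_ne_zero).hasFDerivAt
  have hT1 : ContDiffAt ℝ 1 (fderiv ℝ T) u := hT.fderiv_right (by norm_num)
  have hT2 : HasFDerivAt (fderiv ℝ T) (fderiv ℝ (fderiv ℝ T) u) u :=
    (hT1.differentiableAt one_ne_zero).hasFDerivAt
  set D2 := fderiv ℝ (fderiv ℝ T) u with hD2
  have hsymm : ∀ v w, D2 v w = D2 w v := by
    have : IsSymmSndFDerivAt ℝ T u := hT.isSymmSndFDerivAt (by simp)
    exact fun v w ↦ this v w
  -- the derivative of `|det DT|`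
  have hmul : ∀ y, |(fderiv ℝ T y).det| = |D.det| * |(A ∘L fderiv ℝ T y).det| := by
    intro y
    have h1 : ((A ∘L fderiv ℝ T y)).det = A.det * (fderiv ℝ T y).det := by
      simp [ContinuousLinearMap.det, LinearMap.det_comp]
    have h2 : A.det * D.det = 1 := by
      have : (A ∘L D).det = A.det * D.det := by
        simp [ContinuousLinearMap.det, LinearMap.det_comp]
      rw [← this, hAD]
      simp [ContinuousLinearMap.det]
    rw [h1, ← abs_mul, ← mul_assoc, mul_comm D.det, h2, one_mul]
  have hcomp : HasFDerivAt (fun y ↦ A ∘L fderiv ℝ T y)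
      (((ContinuousLinearMap.compL ℝ 𝔼 𝔼 𝔼) A) ∘L D2) u :=
    ((ContinuousLinearMap.compL ℝ 𝔼 𝔼 𝔼) A).hasFDerivAt.comp u hT2
  have hdet1 : HasFDerivAt (fun L : 𝔼 →L[ℝ] 𝔼 ↦ L.det)
      (fderiv ℝ (fun L : 𝔼 →L[ℝ] 𝔼 ↦ L.det) 1) (A ∘L fderiv ℝ T u) := by
    rw [← hD, hAD]
    exact ((contDiff_det (m := 1)).differentiable one_ne_zero _).hasFDerivAt
  have hdetc := hdet1.comp u hcomp
  set c : 𝔼 →L[ℝ] ℝ := |D.det| • ((fderiv ℝ (fun L : 𝔼 →L[ℝ] 𝔼 ↦ L.det) 1) ∘L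
    ((ContinuousLinearMap.compL ℝ 𝔼 𝔼 𝔼) A) ∘L D2) with hc
  have hcv : ∀ v, c v = |D.det| * LinearMap.trace ℝ 𝔼 (A ∘L D2 v : 𝔼 →L[ℝ] 𝔼) := by
    intro v
    rw [← fderiv_det_one]
    rfl
  have habs : HasFDerivAt (fun y ↦ |(fderiv ℝ T y).det|) c u := by
    refine (hdetc.const_smul |D.det|).congr_of_eventuallyEq ?_
    have hpos : ∀ᶠ y in 𝓝 u, 0 < (A ∘L fderiv ℝ T y).det := by
      refine hdetc.continuousAt.eventually (lt_mem_nhds ?_)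
      simp only [Function.comp_apply]
      rw [← hD, hAD]
      simp [ContinuousLinearMap.det]
    filter_upwards [hpos] with y hy
    rw [hmul, abs_of_pos hy]
    rfl
  -- differentiating the relation between `W'` and `W`
  have hL : HasFDerivAt (fun y ↦ fderiv ℝ T y (W' y)) (D ∘L fderiv ℝ W' u + D2.flip (W' u)) u :=
    hT2.clm_apply hW'.hasFDerivAt
  have hR : HasFDerivAt (fun y ↦ |(fderiv ℝ T y).det| • W (T y))
      (|D.det| • (fderiv ℝ W (T u) ∘L D) + c.smulRight (W (T u))) u :=
    habs.smul (hW.hasFDerivAt.comp u hTd)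
  have heq := hL.unique (hR.congr_of_eventuallyEq h)
  have h0 : W' u = |D.det| • A (W (T u)) := by
    rw [← map_smul, ← h.self_of_nhds, ← hD, hADv]
  -- The product rule on both sides, solved for `DW'`. By symmetry of the second derivative the term
  -- `A (D2 v (W' u))` becomes `A ∘ D2 (W' u)`, whose trace cancels that of the `c` term because `W'
  -- u = |det D| A W`.
  have hA2 : fderiv ℝ W' u = |D.det| • (A ∘L (fderiv ℝ W (T u) ∘L D)) +
      c.smulRight (A (W (T u))) - A ∘L D2 (W' u) := by
    ext1 v
    have := congrArg A (DFunLike.congr_fun heq v)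
    simp only [add_apply, ContinuousLinearMap.comp_apply, map_add, hADv,
      ContinuousLinearMap.flip_apply, smul_apply, map_smul,
      ContinuousLinearMap.smulRight_apply] at this
    simp only [sub_apply, add_apply,
      ContinuousLinearMap.comp_apply, smul_apply,
      ContinuousLinearMap.smulRight_apply]
    rw [hsymm (W' u) v, ← this, add_sub_cancel_right]
  have htr : LinearMap.trace ℝ 𝔼 (A ∘L (fderiv ℝ W (T u) ∘L D) : 𝔼 →L[ℝ] 𝔼) =
      LinearMap.trace ℝ 𝔼 (fderiv ℝ W (T u)) := by
    have := LinearMap.trace_mul_comm ℝ (A : 𝔼 →ₗ[ℝ] 𝔼) ((fderiv ℝ W (T u) ∘L D : 𝔼 →L[ℝ] 𝔼))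
    refine this.trans ?_
    congr 1
    ext1 v
    exact congrArg (fderiv ℝ W (T u)) (DFunLike.congr_fun hDA v)
  rw [hA2, ContinuousLinearMap.toLinearMap_sub, ContinuousLinearMap.toLinearMap_add,
    ContinuousLinearMap.toLinearMap_smul,
    map_sub, map_add, map_smul, htr, trace_smulRight, hcv, h0, map_smul,
    ContinuousLinearMap.comp_smul, ContinuousLinearMap.toLinearMap_smul, map_smul, smul_eq_mul,
    smul_eq_mul]
  ring

end Piola

/-! ### Coordinate vectors, the metric matrix and the gradient in a chart -/

section Charts

theorem sum_smul_map_single {n : ℕ} {V : Type*} [AddCommGroup V] [Module ℝ V]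
    (L : EuclideanSpace ℝ (Fin n) →ₗ[ℝ] V)
    (c : EuclideanSpace ℝ (Fin n)) :
    ∑ i, c i • L (EuclideanSpace.single i 1) = L c := by
  conv_rhs => rw [← (EuclideanSpace.basisFun (Fin n) ℝ).sum_repr c]
  rw [map_sum]
  simp

variable {n : ℕ} {M : Type*} [TopologicalSpace M] [ChartedSpace (EuclideanSpace ℝ (Fin n)) M]
  [IsManifold (𝓡 n) ω M]

local notation "𝔼" => EuclideanSpace ℝ (Fin n)

theorem mfderiv_extChartAt_comp_mfderiv_symm (x : M) {y : 𝔼}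
    (hy : y ∈ (extChartAt (𝓡 n) x).target) (v : 𝔼) :
    mfderiv (𝓡 n) 𝓘(ℝ, 𝔼) (extChartAt (𝓡 n) x) ((extChartAt (𝓡 n) x).symm y)
      (mfderiv 𝓘(ℝ, 𝔼) (𝓡 n) (extChartAt (𝓡 n) x).symm y v) = v := by
  have := mfderiv_extChartAt_comp_mfderivWithin_extChartAt_symm (I := 𝓡 n) hy
  simp only [ModelWithCorners.range_eq_univ, mfderivWithin_univ] at this
  exact DFunLike.congr_fun this v

theorem mfderiv_symm_comp_mfderiv_extChartAt (x : M) {y : 𝔼}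
    (hy : y ∈ (extChartAt (𝓡 n) x).target)
    (v : TangentSpace (𝓡 n) ((extChartAt (𝓡 n) x).symm y)) :
    mfderiv 𝓘(ℝ, 𝔼) (𝓡 n) (extChartAt (𝓡 n) x).symm y
      (mfderiv (𝓡 n) 𝓘(ℝ, 𝔼) (extChartAt (𝓡 n) x) ((extChartAt (𝓡 n) x).symm y) v) = v := by
  have := mfderivWithin_extChartAt_symm_comp_mfderiv_extChartAt (I := 𝓡 n) hy
  simp only [ModelWithCorners.range_eq_univ, mfderivWithin_univ] at this
  exact DFunLike.congr_fun this v

/-- This ties the coordinate vectors to the tangent bundle trivialization, whose frames are analytic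
sections. -/
theorem coordVector_eq_symmL (x : M) (i : Fin n) {p : M} (hp : p ∈ (chartAt 𝔼 x).source) :
    (coordVector x i (extChartAt (𝓡 n) x p) : 𝔼) =
      (trivializationAt 𝔼 (TangentSpace (𝓡 n)) x).symmL ℝ p (EuclideanSpace.single i 1) := by
  rw [TangentBundle.symmL_trivializationAt hp]
  simp only [ModelWithCorners.range_eq_univ, mfderivWithin_univ]
  rfl

theorem contMDiffAt_extChartAt_symm (x : M) {y : 𝔼} (hy : y ∈ (extChartAt (𝓡 n) x).target) :
    ContMDiffAt 𝓘(ℝ, 𝔼) (𝓡 n) ω (extChartAt (𝓡 n) x).symm y :=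
  (contMDiffOn_extChartAt_symm x).contMDiffAt ((isOpen_extChartAt_target x).mem_nhds hy)

theorem fderiv_comp_extChartAt_symm {f : M → ℝ} (x : M) {y : 𝔼}
    (hy : y ∈ (extChartAt (𝓡 n) x).target)
    (hf : ContMDiffAt (𝓡 n) 𝓘(ℝ, ℝ) ω f ((extChartAt (𝓡 n) x).symm y)) (v : 𝔼) :
    fderiv ℝ (f ∘ (extChartAt (𝓡 n) x).symm) y v =
      mfderiv (𝓡 n) 𝓘(ℝ, ℝ) f ((extChartAt (𝓡 n) x).symm y)
        (mfderiv 𝓘(ℝ, 𝔼) (𝓡 n) (extChartAt (𝓡 n) x).symm y v) := by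
  rw [← mfderiv_eq_fderiv, mfderiv_comp y (hf.mdifferentiableAt (by simp))
    ((contMDiffAt_extChartAt_symm x hy).mdifferentiableAt (by simp))]
  rfl

theorem contDiffAt_comp_extChartAt_symm {f : M → ℝ} (x : M) {y : 𝔼}
    (hy : y ∈ (extChartAt (𝓡 n) x).target)
    (hf : ContMDiffAt (𝓡 n) 𝓘(ℝ, ℝ) ω f ((extChartAt (𝓡 n) x).symm y)) :
    ContDiffAt ℝ ω (f ∘ (extChartAt (𝓡 n) x).symm) y :=
  (hf.comp y (contMDiffAt_extChartAt_symm x hy)).contDiffAt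

omit [IsManifold (𝓡 n) ω M] in
theorem contMDiffAt_of_comp_extChartAt_symm {f : M → ℝ} (x : M)
    (hf : ContDiffAt ℝ ω (f ∘ (extChartAt (𝓡 n) x).symm) (extChartAt (𝓡 n) x x)) :
    ContMDiffAt (𝓡 n) 𝓘(ℝ, ℝ) ω f x := by
  have h := hf.contMDiffAt.comp x (contMDiffAt_extChartAt (I := 𝓡 n) (n := ω) (x := x))
  refine h.congr_of_eventuallyEq ?_
  filter_upwards [extChartAt_source_mem_nhds (I := 𝓡 n) x] with p hp
  exact (congrArg f ((extChartAt (𝓡 n) x).left_inv hp)).symm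

omit [IsManifold (𝓡 n) ω M] in
theorem sum_smul_coordVector (x : M) {y : 𝔼} (c : 𝔼) :
    ∑ i, c i • coordVector x i y =
      mfderiv 𝓘(ℝ, 𝔼) (𝓡 n) (extChartAt (𝓡 n) x).symm y c := by
  exact sum_smul_map_single (V := TangentSpace (𝓡 n) ((extChartAt (𝓡 n) x).symm y))
    (mfderiv 𝓘(ℝ, 𝔼) (𝓡 n) (extChartAt (𝓡 n) x).symm y).toLinearMap c

theorem sum_coordField_smul_coordVector (X : ∀ z : M, TangentSpace (𝓡 n) z) (x : M) {y : 𝔼}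
    (hy : y ∈ (extChartAt (𝓡 n) x).target) :
    ∑ i, coordField X x y i • coordVector x i y = X ((extChartAt (𝓡 n) x).symm y) := by
  rw [sum_smul_coordVector, coordField, mfderiv_symm_comp_mfderiv_extChartAt x hy]

theorem linearIndependent_coordVector (x : M) {y : 𝔼} (hy : y ∈ (extChartAt (𝓡 n) x).target) :
    LinearIndependent ℝ (fun i ↦ coordVector x i y) := by
  rw [Fintype.linearIndependent_iff]
  intro c hc i
  have h1 := sum_smul_coordVector x (y := y) (WithLp.toLp 2 c)
  have h2 := mfderiv_extChartAt_comp_mfderiv_symm x hy (WithLp.toLp 2 c)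
  rw [← h1, hc, map_zero] at h2
  exact (congrArg (fun v : 𝔼 ↦ v i) h2).symm

variable [RiemannianBundle (fun x : M ↦ TangentSpace (𝓡 n) x)]

omit [IsManifold (𝓡 n) ω M] in
theorem inner_riemGradient (f : M → ℝ) (p : M) (v : TangentSpace (𝓡 n) p) :
    inner ℝ (riemGradient (n := n) f p) v = mfderiv (𝓡 n) 𝓘(ℝ, ℝ) f p v := by
  have : FiniteDimensional ℝ (TangentSpace (𝓡 n) p) :=
    inferInstanceAs (FiniteDimensional ℝ (EuclideanSpace ℝ (Fin n)))
  have : CompleteSpace (TangentSpace (𝓡 n) p) := FiniteDimensional.complete ℝ _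
  exact InnerProductSpace.toDual_symm_apply (𝕜 := ℝ) (E := TangentSpace (𝓡 n) p)

omit [IsManifold (𝓡 n) ω M] in
theorem gradSq_eq (f : M → ℝ) (p : M) :
    gradSq (n := n) f p = mfderiv (𝓡 n) 𝓘(ℝ, ℝ) f p (riemGradient (n := n) f p) :=
  inner_riemGradient f p _

theorem metricMatrix_det_pos (x : M) {y : 𝔼} (hy : y ∈ (extChartAt (𝓡 n) x).target) :
    0 < (metricMatrix x y).det := by
  have h := Matrix.posDef_gram_of_linearIndependent (𝕜 := ℝ)
    (E := TangentSpace (𝓡 n) ((extChartAt (𝓡 n) x).symm y)) (linearIndependent_coordVector x hy)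
  exact h.det_pos

theorem volDensity_pos (x : M) {y : 𝔼} (hy : y ∈ (extChartAt (𝓡 n) x).target) :
    0 < volDensity x y :=
  Real.sqrt_pos.2 (metricMatrix_det_pos x hy)

/-- Pairing `∇f = ∑ Xⁱ ∂ᵢ` with `∂ⱼ` gives a linear system for the gradient components, with an
invertible matrix. -/
theorem metricMatrix_mulVec_coordField {f : M → ℝ} (x : M) {y : 𝔼}
    (hy : y ∈ (extChartAt (𝓡 n) x).target)
    (hf : ContMDiffAt (𝓡 n) 𝓘(ℝ, ℝ) ω f ((extChartAt (𝓡 n) x).symm y)) :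
    (metricMatrix x y).mulVec (coordField (riemGradient f) x y) =
      fun j ↦ fderiv ℝ (f ∘ (extChartAt (𝓡 n) x).symm) y (EuclideanSpace.single j 1) := by
  funext j
  rw [fderiv_comp_extChartAt_symm x hy hf]
  change _ = mfderiv (𝓡 n) 𝓘(ℝ, ℝ) f ((extChartAt (𝓡 n) x).symm y) (coordVector x j y)
  rw [← inner_riemGradient, ← sum_coordField_smul_coordVector (riemGradient f) x hy, sum_inner]
  simp only [Matrix.mulVec, dotProduct, metricMatrix, Matrix.of_apply, real_inner_smul_left]
  refine Finset.sum_congr rfl fun i _ ↦ ?_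
  rw [mul_comm, real_inner_comm]

end Charts

/-! ### Analyticity of the metric, the gradient and its squared norm -/

section ChartFrame

variable {n : ℕ} {M : Type*} [TopologicalSpace M] [ChartedSpace (EuclideanSpace ℝ (Fin n)) M]
  [IsManifold (𝓡 n) ω M]

local notation "𝔼" => EuclideanSpace ℝ (Fin n)

/-- The coordinate frame of the preferred chart at `x`, as a family of vector fields on `M`. -/
def chartFrame (x : M) (i : Fin n) (p : M) : TangentSpace (𝓡 n) p :=
  (trivializationAt 𝔼 (TangentSpace (𝓡 n)) x).localFrame
    (EuclideanSpace.basisFun (Fin n) ℝ).toBasis i p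

theorem contMDiffAt_chartFrame (x : M) (i : Fin n) {p : M} (hp : p ∈ (chartAt 𝔼 x).source) :
    ContMDiffAt (𝓡 n) ((𝓡 n).prod 𝓘(ℝ, 𝔼)) ω
      (fun q ↦ (⟨q, chartFrame x i q⟩ : TotalSpace 𝔼 (TangentSpace (𝓡 n) (M := M)))) p :=
  ((trivializationAt 𝔼 (TangentSpace (𝓡 n)) x).contMDiffOn_localFrame_baseSet ω
    (EuclideanSpace.basisFun (Fin n) ℝ).toBasis i).contMDiffAt
    ((chartAt 𝔼 x).open_source.mem_nhds hp)

theorem chartFrame_eq_symmL (x : M) (i : Fin n) {p : M} (hp : p ∈ (chartAt 𝔼 x).source) :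
    chartFrame x i p =
      (trivializationAt 𝔼 (TangentSpace (𝓡 n)) x).symmL ℝ p (EuclideanSpace.single i 1) := by
  rw [chartFrame, Trivialization.localFrame_apply_of_mem_baseSet (hx := hp)]
  simp only [Trivialization.basisAt, Module.Basis.map_apply, OrthonormalBasis.coe_toBasis,
    EuclideanSpace.basisFun_apply]
  exact (Trivialization.linearEquivAt_symm_apply ..).trans
    (Trivialization.symmL_apply (hb := hp) ..).symm

theorem coordVector_eq_chartFrame (x : M) (i : Fin n) {y : 𝔼}
    (hy : y ∈ (extChartAt (𝓡 n) x).target) :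
    coordVector x i y = chartFrame x i ((extChartAt (𝓡 n) x).symm y) := by
  have hp : (extChartAt (𝓡 n) x).symm y ∈ (chartAt 𝔼 x).source := by
    rw [← extChartAt_source (𝓡 n)]; exact (extChartAt (𝓡 n) x).map_target hy
  have h := coordVector_eq_symmL x i hp
  have h2 : (coordVector x i (extChartAt (𝓡 n) x ((extChartAt (𝓡 n) x).symm y)) : 𝔼) =
      coordVector x i y :=
    congrArg (fun w ↦ (coordVector x i w : 𝔼)) ((extChartAt (𝓡 n) x).right_inv hy)
  rw [chartFrame_eq_symmL x i hp]
  exact h2.symm.trans h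

/-- The differential at `p` of the preferred chart at `x`. -/
def chartDeriv (x p : M) : TangentSpace (𝓡 n) p →L[ℝ] 𝔼 :=
  mfderiv (𝓡 n) 𝓘(ℝ, 𝔼) (extChartAt (𝓡 n) x) p

theorem sum_chartDeriv_smul_chartFrame (x : M) {p : M} (hp : p ∈ (chartAt 𝔼 x).source)
    (v : TangentSpace (𝓡 n) p) :
    ∑ i, chartDeriv x p v i • chartFrame x i p = v := by
  simp only [chartFrame_eq_symmL x _ hp]
  rw [chartDeriv]
  rw [← TangentBundle.continuousLinearMapAt_trivializationAt hp]
  refine (sum_smul_map_single (V := TangentSpace (𝓡 n) p)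
    ((trivializationAt 𝔼 (TangentSpace (𝓡 n)) x).symmL ℝ p).toLinearMap _).trans ?_
  exact (trivializationAt 𝔼 (TangentSpace (𝓡 n)) x).symmL_continuousLinearMapAt hp v

variable [RiemannianBundle (fun x : M ↦ TangentSpace (𝓡 n) x)]

/-- The matrix of the metric at `p` in the coordinate frame of the preferred chart at `x`. -/
def chartMetric (x p : M) : Matrix (Fin n) (Fin n) ℝ :=
  Matrix.of fun i j ↦ inner ℝ (chartFrame x i p) (chartFrame x j p)

theorem metricMatrix_eq_chartMetric (x : M) {y : 𝔼} (hy : y ∈ (extChartAt (𝓡 n) x).target) :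
    metricMatrix x y = chartMetric x ((extChartAt (𝓡 n) x).symm y) := by
  ext i j
  simp only [metricMatrix, chartMetric, Matrix.of_apply, coordVector_eq_chartFrame x _ hy]

/-- Change of the metric matrix between two charts. -/
theorem chartMetric_change (x z : M) {p : M} (hx : p ∈ (chartAt 𝔼 x).source)
    (J : Matrix (Fin n) (Fin n) ℝ)
    (hJ : J = Matrix.of fun i j ↦
      chartDeriv x p (chartFrame z j p) i) :
    chartMetric z p = J.transpose * chartMetric x p * J := by
  ext i j
  have h := fun k ↦ sum_chartDeriv_smul_chartFrame x hx (chartFrame z k p)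
  simp only [chartMetric, Matrix.of_apply]
  rw [← h i, ← h j]
  simp only [sum_inner, inner_sum, real_inner_smul_left, real_inner_smul_right, Matrix.mul_apply,
    Matrix.transpose_apply, hJ, Matrix.of_apply, Finset.sum_mul]
  refine Finset.sum_congr rfl fun a _ ↦ Finset.sum_congr rfl fun b _ ↦ ?_
  ring

variable [IsContMDiffRiemannianBundle (𝓡 n) ω (EuclideanSpace ℝ (Fin n))
        (fun x : M ↦ TangentSpace (𝓡 n) x)]

theorem contDiffAt_metricMatrix (x : M) {y : 𝔼} (hy : y ∈ (extChartAt (𝓡 n) x).target)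
    (i j : Fin n) : ContDiffAt ℝ ω (fun w ↦ metricMatrix x w i j) y := by
  have hp : (extChartAt (𝓡 n) x).symm y ∈ (chartAt 𝔼 x).source := by
    rw [← extChartAt_source (𝓡 n)]; exact (extChartAt (𝓡 n) x).map_target hy
  have h : ContMDiffAt (𝓡 n) 𝓘(ℝ, ℝ) ω (fun p ↦ chartMetric x p i j)
      ((extChartAt (𝓡 n) x).symm y) :=
    (contMDiffAt_chartFrame x i hp).inner_bundle (contMDiffAt_chartFrame x j hp)
  refine (contDiffAt_comp_extChartAt_symm x hy h).congr_of_eventuallyEq ?_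
  filter_upwards [(isOpen_extChartAt_target x).mem_nhds hy] with w hw
  rw [metricMatrix_eq_chartMetric x hw]
  rfl

theorem contDiffAt_det {F : Type*} [NormedAddCommGroup F] [NormedSpace ℝ F] {m : ℕ∞ω}
    {A : F → Matrix (Fin n) (Fin n) ℝ} {y : F} (hA : ∀ i j, ContDiffAt ℝ m (fun w ↦ A w i j) y) :
    ContDiffAt ℝ m (fun w ↦ (A w).det) y := by
  simp only [Matrix.det_apply]
  exact ContDiffAt.sum fun σ _ ↦ ContDiffAt.const_smul _ (contDiffAt_prod fun i _ ↦ hA _ _)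

theorem contDiffAt_volDensity (x : M) {y : 𝔼} (hy : y ∈ (extChartAt (𝓡 n) x).target) :
    ContDiffAt ℝ ω (volDensity (n := n) x) y :=
  (contDiffAt_det (contDiffAt_metricMatrix x hy)).sqrt (metricMatrix_det_pos x hy).ne'

theorem contDiffAt_coordField_riemGradient {f : M → ℝ} (hf : ContMDiff (𝓡 n) 𝓘(ℝ, ℝ) ω f) (x : M)
    {y : 𝔼} (hy : y ∈ (extChartAt (𝓡 n) x).target) :
    ContDiffAt ℝ ω (coordField (riemGradient f) x) y := by
  set d : 𝔼 → Fin n → ℝ := fun w j ↦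
    fderiv ℝ (f ∘ (extChartAt (𝓡 n) x).symm) w (EuclideanSpace.single j 1) with hd
  have hdc : ∀ j, ContDiffAt ℝ ω (fun w ↦ d w j) y := fun j ↦
    ((contDiffAt_comp_extChartAt_symm x hy (hf _)).fderiv_right (m := ω) (by simp)).clm_apply
      contDiffAt_const
  rw [contDiffAt_euclidean]
  intro i
  -- Cramer's rule expresses the solution of `g X = df` through determinants with analytic entries.
  have h1 : ContDiffAt ℝ ω (fun w ↦ ((metricMatrix x w).det)⁻¹ *
      ((metricMatrix x w).updateCol i (d w)).det) y := by
    refine ((contDiffAt_det (contDiffAt_metricMatrix x hy)).inv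
      (metricMatrix_det_pos x hy).ne').mul (contDiffAt_det fun a b ↦ ?_)
    by_cases hb : b = i
    · subst hb
      simpa using hdc a
    · simpa [hb] using contDiffAt_metricMatrix x hy a b
  refine h1.congr_of_eventuallyEq ?_
  filter_upwards [(isOpen_extChartAt_target x).mem_nhds hy] with w hw
  have h2 : (metricMatrix x w).mulVec (coordField (riemGradient f) x w) = d w :=
    metricMatrix_mulVec_coordField x hw (hf _)
  rw [← Matrix.cramer_apply, Matrix.cramer_eq_adjugate_mulVec, ← h2, Matrix.mulVec_mulVec,
    Matrix.adjugate_mul, Matrix.smul_mulVec, Matrix.one_mulVec]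
  simp [(metricMatrix_det_pos x hw).ne']

theorem contMDiff_gradSq {f : M → ℝ} (hf : ContMDiff (𝓡 n) 𝓘(ℝ, ℝ) ω f) :
    ContMDiff (𝓡 n) 𝓘(ℝ, ℝ) ω (gradSq (n := n) f) := by
  intro x
  have hy := mem_extChartAt_target (I := 𝓡 n) x
  refine contMDiffAt_of_comp_extChartAt_symm x ?_
  have h1 : ContDiffAt ℝ ω (fun w ↦ fderiv ℝ (f ∘ (extChartAt (𝓡 n) x).symm) w
      (coordField (riemGradient f) x w)) (extChartAt (𝓡 n) x x) :=
    ((contDiffAt_comp_extChartAt_symm x hy (hf _)).fderiv_right (m := ω) (by simp)).clm_apply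
      (contDiffAt_coordField_riemGradient hf x hy)
  refine h1.congr_of_eventuallyEq ?_
  filter_upwards [(isOpen_extChartAt_target x).mem_nhds hy] with w hw
  rw [fderiv_comp_extChartAt_symm x hw (hf _), coordField,
    mfderiv_symm_comp_mfderiv_extChartAt x hw]
  exact gradSq_eq f _

end ChartFrame

/-! ### Chart independence and analyticity of the divergence -/

section Divergence

variable {n : ℕ} {M : Type*} [TopologicalSpace M] [ChartedSpace (EuclideanSpace ℝ (Fin n)) M]
  [IsManifold (𝓡 n) ω M]

local notation "𝔼" => EuclideanSpace ℝ (Fin n)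

/-- The transition map from the preferred chart at `z` to the preferred chart at `x`. -/
def transition (x z : M) : 𝔼 → 𝔼 :=
  extChartAt (𝓡 n) x ∘ (extChartAt (𝓡 n) z).symm

theorem contDiffAt_transition {x z : M} {u : 𝔼} (hu : u ∈ (extChartAt (𝓡 n) z).target)
    (hx : (extChartAt (𝓡 n) z).symm u ∈ (chartAt 𝔼 x).source) :
    ContDiffAt ℝ ω (transition x z) u :=
  ((contMDiffAt_extChartAt' hx).comp u (contMDiffAt_extChartAt_symm z hu)).contDiffAt

theorem fderiv_transition {x z : M} {u : 𝔼} (hu : u ∈ (extChartAt (𝓡 n) z).target)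
    (hx : (extChartAt (𝓡 n) z).symm u ∈ (chartAt 𝔼 x).source) (v : 𝔼) :
    fderiv ℝ (transition x z) u v = chartDeriv x ((extChartAt (𝓡 n) z).symm u)
      (mfderiv 𝓘(ℝ, 𝔼) (𝓡 n) (extChartAt (𝓡 n) z).symm u v) := by
  rw [← mfderiv_eq_fderiv, transition, mfderiv_comp u
    ((contMDiffAt_extChartAt' (n := ω) hx).mdifferentiableAt (by simp))
    ((contMDiffAt_extChartAt_symm z hu).mdifferentiableAt (by simp))]
  rfl

theorem fderiv_transition_coordField (X : ∀ z : M, TangentSpace (𝓡 n) z) {x z : M} {u : 𝔼}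
    (hu : u ∈ (extChartAt (𝓡 n) z).target)
    (hx : (extChartAt (𝓡 n) z).symm u ∈ (chartAt 𝔼 x).source) :
    fderiv ℝ (transition x z) u (coordField X z u) = coordField X x (transition x z u) := by
  rw [fderiv_transition hu hx]
  have h := mfderiv_symm_comp_mfderiv_extChartAt z hu (X ((extChartAt (𝓡 n) z).symm u))
  rw [← extChartAt_source (𝓡 n)] at hx
  refine (congrArg (chartDeriv x ((extChartAt (𝓡 n) z).symm u)) h).trans ?_
  exact (congrArg (fun q ↦ chartDeriv x q (X q)) ((extChartAt (𝓡 n) x).left_inv hx)).symm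

theorem fderiv_transition_det_ne_zero {x z : M} {u : 𝔼} (hu : u ∈ (extChartAt (𝓡 n) z).target)
    (hx : (extChartAt (𝓡 n) z).symm u ∈ (chartAt 𝔼 x).source) :
    (fderiv ℝ (transition x z) u).det ≠ 0 := by
  have hinj : Function.Injective (fderiv ℝ (transition x z) u) := by
    refine (injective_iff_map_eq_zero _).2 fun v hv ↦ ?_
    rw [fderiv_transition hu hx] at hv
    have h1 := sum_chartDeriv_smul_chartFrame x hx
      (mfderiv 𝓘(ℝ, 𝔼) (𝓡 n) (extChartAt (𝓡 n) z).symm u v)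
    rw [hv] at h1
    have h0 := h1.symm.trans (Finset.sum_eq_zero fun i _ ↦ zero_smul ℝ (chartFrame x i _))
    have h2 := mfderiv_extChartAt_comp_mfderiv_symm z hu v
    rw [h0, map_zero] at h2
    exact h2.symm
  have := LinearMap.ker_eq_bot.2 hinj
  exact fun h ↦ (LinearMap.bot_lt_ker_of_det_eq_zero h).ne' this

variable [RiemannianBundle (fun x : M ↦ TangentSpace (𝓡 n) x)]

/-- The metric matrices satisfy `g_z = Jᵀ g_x J` with `J` the Jacobian of the transition; take
determinants and square roots. -/
theorem volDensity_transition {x z : M} {u : 𝔼} (hu : u ∈ (extChartAt (𝓡 n) z).target)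
    (hx : (extChartAt (𝓡 n) z).symm u ∈ (chartAt 𝔼 x).source) :
    volDensity z u = |(fderiv ℝ (transition x z) u).det| * volDensity x (transition x z u) := by
  have hx' := hx
  rw [← extChartAt_source (𝓡 n)] at hx'
  have h1 : metricMatrix x (transition x z u) = chartMetric x ((extChartAt (𝓡 n) z).symm u) := by
    refine (metricMatrix_eq_chartMetric x ((extChartAt (𝓡 n) x).map_source hx')).trans ?_
    exact congrArg (chartMetric x) ((extChartAt (𝓡 n) x).left_inv hx')
  have h2 := chartMetric_change x z hx (Matrix.of fun i j ↦
    fderiv ℝ (transition x z) u (EuclideanSpace.single j 1) i) (by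
      ext i j
      rw [Matrix.of_apply, Matrix.of_apply, fderiv_transition hu hx,
        ← coordVector_eq_chartFrame z j hu]
      rfl)
  rw [volDensity, volDensity, h1, metricMatrix_eq_chartMetric z hu, h2, det_eq_det_of_single,
    Matrix.det_mul, Matrix.det_mul, Matrix.det_transpose, ← Real.sqrt_sq_eq_abs,
    ← Real.sqrt_mul (sq_nonneg _)]
  congr 1
  ring

/-- The coordinate expression of the divergence in the preferred chart at `x`. -/
def chartDivergence (X : ∀ z : M, TangentSpace (𝓡 n) z) (x : M) (y : 𝔼) : ℝ :=
  (volDensity (n := n) x y)⁻¹ *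
    ∑ i : Fin n, fderiv ℝ (fun w ↦ volDensity x w * coordField X x w i) y
      (EuclideanSpace.single i (1 : ℝ))

omit [IsManifold (𝓡 n) ω M] in
theorem chartDivergence_eq_trace (X : ∀ z : M, TangentSpace (𝓡 n) z) (x : M) {y : 𝔼}
    (h : DifferentiableAt ℝ (fun w ↦ volDensity x w • coordField X x w) y) :
    chartDivergence X x y = (volDensity (n := n) x y)⁻¹ *
      LinearMap.trace ℝ 𝔼 (fderiv ℝ (fun w ↦ volDensity x w • coordField X x w) y) := by
  rw [trace_eq_sum_single, chartDivergence]
  congr 1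
  refine Finset.sum_congr rfl fun i _ ↦ ?_
  have h2 := (EuclideanSpace.proj i : 𝔼 →L[ℝ] ℝ).hasFDerivAt.comp y
    h.hasFDerivAt
  exact congrArg (fun L : 𝔼 →L[ℝ] ℝ ↦ L (EuclideanSpace.single i 1)) h2.fderiv

variable [IsContMDiffRiemannianBundle (𝓡 n) ω (EuclideanSpace ℝ (Fin n))
        (fun x : M ↦ TangentSpace (𝓡 n) x)]

/-- The divergence does not depend on the chart. -/
theorem divergence_eq_chartDivergence {X : ∀ z : M, TangentSpace (𝓡 n) z}
    (hX : ∀ x : M, ∀ y ∈ (extChartAt (𝓡 n) x).target, ContDiffAt ℝ ω (coordField X x) y)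
    (x : M) {z : M} (hz : z ∈ (chartAt 𝔼 x).source) :
    divergence (n := n) X z = chartDivergence X x (extChartAt (𝓡 n) x z) := by
  have hd : ∀ x : M, ∀ y ∈ (extChartAt (𝓡 n) x).target,
      DifferentiableAt ℝ (fun w ↦ volDensity x w • coordField X x w) y := fun x y hy ↦
    ((contDiffAt_volDensity x hy).smul (hX x y hy)).differentiableAt (by simp)
  set u := extChartAt (𝓡 n) z z with hu
  have hut : u ∈ (extChartAt (𝓡 n) z).target := mem_extChartAt_target z
  have huz : (extChartAt (𝓡 n) z).symm u = z := extChartAt_to_inv z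
  have hux : (extChartAt (𝓡 n) z).symm u ∈ (chartAt 𝔼 x).source := by rwa [huz]
  have hT : transition x z u = extChartAt (𝓡 n) x z := by
    rw [transition, Function.comp_apply, huz]
  have hTt : extChartAt (𝓡 n) x z ∈ (extChartAt (𝓡 n) x).target :=
    (extChartAt (𝓡 n) x).map_source (by rwa [extChartAt_source])
  have hdet := fderiv_transition_det_ne_zero hut hux
  -- Components transform by `DT` and densities by `|det DT|`, so the fields `√(det g) X` satisfy
  -- the Piola hypothesis.
  have hev : ∀ᶠ y in 𝓝 u, fderiv ℝ (transition x z) y (volDensity z y • coordField X z y) =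
      |(fderiv ℝ (transition x z) y).det| •
        (volDensity x (transition x z y) • coordField X x (transition x z y)) := by
    have hc : ∀ᶠ y in 𝓝 u, (extChartAt (𝓡 n) z).symm y ∈ (chartAt 𝔼 x).source :=
      (contMDiffAt_extChartAt_symm z hut).continuousAt ((chartAt 𝔼 x).open_source.mem_nhds hux)
    filter_upwards [hc, (isOpen_extChartAt_target z).mem_nhds hut] with y hy1 hy2
    rw [map_smul, fderiv_transition_coordField X hy2 hy1, volDensity_transition hy2 hy1, mul_smul]
  have hP := trace_fderiv_of_pullback ((contDiffAt_transition hut hux).of_le le_top) hdet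
    (by rw [hT]; exact hd x _ hTt) (hd z u hut) hev
  change chartDivergence X z u = _
  rw [chartDivergence_eq_trace X z (hd z u hut), chartDivergence_eq_trace X x (hd x _ hTt), hP,
    volDensity_transition hut hux, hT, mul_inv, mul_mul_mul_comm,
    inv_mul_cancel₀ (abs_ne_zero.2 hdet), one_mul]

/-- The chart used by `divergence` varies with the point; by chart independence one fixed chart
serves on a whole neighbourhood. -/
theorem contMDiff_divergence {X : ∀ z : M, TangentSpace (𝓡 n) z}
    (hX : ∀ x : M, ∀ y ∈ (extChartAt (𝓡 n) x).target, ContDiffAt ℝ ω (coordField X x) y) :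
    ContMDiff (𝓡 n) 𝓘(ℝ, ℝ) ω (divergence (n := n) X) := by
  intro x
  have hy := mem_extChartAt_target (I := 𝓡 n) x
  refine contMDiffAt_of_comp_extChartAt_symm x ?_
  have h1 : ContDiffAt ℝ ω (chartDivergence X x) (extChartAt (𝓡 n) x x) := by
    refine ((contDiffAt_volDensity x hy).inv (volDensity_pos x hy).ne').mul
      (ContDiffAt.sum fun i _ ↦ ?_)
    exact (((contDiffAt_volDensity x hy).mul (contDiffAt_euclidean.1 (hX x _ hy) i)).fderiv_right
      (m := ω) (by simp)).clm_apply contDiffAt_const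
  refine h1.congr_of_eventuallyEq ?_
  filter_upwards [(isOpen_extChartAt_target x).mem_nhds hy] with w hw
  have hs : (extChartAt (𝓡 n) x).symm w ∈ (chartAt 𝔼 x).source := by
    rw [← extChartAt_source (𝓡 n)]; exact (extChartAt (𝓡 n) x).map_target hw
  rw [Function.comp_apply, divergence_eq_chartDivergence hX x hs,
    (extChartAt (𝓡 n) x).right_inv hw]

theorem contMDiff_laplacian {f : M → ℝ} (hf : ContMDiff (𝓡 n) 𝓘(ℝ, ℝ) ω f) :
    ContMDiff (𝓡 n) 𝓘(ℝ, ℝ) ω (laplacian (n := n) f) :=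
  contMDiff_divergence fun x _ hy ↦ contDiffAt_coordField_riemGradient hf x hy

end Divergence

/-! ### Equilibrium functions are locally isoparametric -/

section Isoparametric

variable {n : ℕ} {M : Type*} [TopologicalSpace M] [ChartedSpace (EuclideanSpace ℝ (Fin n)) M]
  [IsManifold (𝓡 n) ω M]

local notation "𝔼" => EuclideanSpace ℝ (Fin n)

theorem extChartAt_symm_mem_criticalSet_iff {f : M → ℝ} (hf : ContMDiff (𝓡 n) 𝓘(ℝ, ℝ) ω f) (x : M)
    {y : 𝔼} (hy : y ∈ (extChartAt (𝓡 n) x).target) :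
    (extChartAt (𝓡 n) x).symm y ∈ criticalSet (n := n) f ↔
      fderiv ℝ (f ∘ (extChartAt (𝓡 n) x).symm) y = 0 := by
  constructor
  · intro h
    ext v
    rw [fderiv_comp_extChartAt_symm x hy (hf _)]
    exact DFunLike.congr_fun h _
  · intro h
    refine ContinuousLinearMap.ext fun w ↦ ?_
    have h1 := fderiv_comp_extChartAt_symm x hy (hf _) (chartDeriv x _ w)
    rw [h] at h1
    exact (congrArg (mfderiv (𝓡 n) 𝓘(ℝ, ℝ) f ((extChartAt (𝓡 n) x).symm y))
      (mfderiv_symm_comp_mfderiv_extChartAt x hy w)).symm.trans h1.symm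

theorem fderiv_comp_extChartAt_symm_ne_zero {f : M → ℝ} (hf : ContMDiff (𝓡 n) 𝓘(ℝ, ℝ) ω f) {x : M}
    (hx : x ∉ criticalSet (n := n) f) :
    fderiv ℝ (f ∘ (extChartAt (𝓡 n) x).symm) (extChartAt (𝓡 n) x x) ≠ 0 := by
  rwa [Ne, ← extChartAt_symm_mem_criticalSet_iff hf x (mem_extChartAt_target x),
    extChartAt_to_inv]

theorem isClosed_criticalSet {f : M → ℝ} (hf : ContMDiff (𝓡 n) 𝓘(ℝ, ℝ) ω f) :
    IsClosed (criticalSet (n := n) f) := by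
  rw [← isOpen_compl_iff, isOpen_iff_mem_nhds]
  intro x hx
  have h0 := fderiv_comp_extChartAt_symm_ne_zero hf hx
  have hc : ContinuousAt (fderiv ℝ (f ∘ (extChartAt (𝓡 n) x).symm)) (extChartAt (𝓡 n) x x) :=
    ((contDiffAt_comp_extChartAt_symm x (mem_extChartAt_target x) (hf _)).fderiv_right
      (m := ω) (by simp)).continuousAt
  have hev := (continuousAt_extChartAt (I := 𝓡 n) x).eventually (hc.eventually_ne h0)
  filter_upwards [hev, extChartAt_source_mem_nhds (I := 𝓡 n) x] with p hp1 hp2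
  rw [Ne, ← extChartAt_symm_mem_criticalSet_iff hf x ((extChartAt (𝓡 n) x).map_source hp2),
    (extChartAt (𝓡 n) x).left_inv hp2] at hp1
  exact hp1

/-- A nonzero differential is onto `ℝ`, so the coordinate expression of `f` is open at the point. -/
theorem nhds_le_map_nhds_of_notMem_criticalSet {f : M → ℝ} (hf : ContMDiff (𝓡 n) 𝓘(ℝ, ℝ) ω f)
    {x : M} (hx : x ∉ criticalSet (n := n) f) : 𝓝 (f x) ≤ map f (𝓝 x) := by
  have h0 := fderiv_comp_extChartAt_symm_ne_zero hf hx
  have hs := (contDiffAt_comp_extChartAt_symm x (mem_extChartAt_target x) (hf _)).hasStrictFDerivAt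
    (by simp)
  have hmap := hs.map_nhds_eq_of_surj (LinearMap.range_eq_top.2 <|
    LinearMap.surjective fun h ↦ h0 (ContinuousLinearMap.coe_inj.1 h))
  rw [Function.comp_apply, extChartAt_to_inv, ← map_map] at hmap
  rw [← hmap]
  refine map_mono ?_
  have := (continuousAt_extChartAt_symm (I := 𝓡 n) x).tendsto
  rwa [extChartAt_to_inv] at this

/-- Near a regular point of `f`, an analytic function which is constant on the connected components
of the fibres of `f` is an analytic function of `f`. -/
theorem exists_analyticAt_of_constant_on_leaves {f h : M → ℝ}
    (hf : ContMDiff (𝓡 n) 𝓘(ℝ, ℝ) ω f) (hh : ContMDiff (𝓡 n) 𝓘(ℝ, ℝ) ω h)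
    (hconst : ∀ p, ∀ q ∈ connectedComponentIn (f ⁻¹' {f p}) p, h q = h p)
    {x : M} (hx : x ∉ criticalSet (n := n) f) :
    ∃ F : ℝ → ℝ, AnalyticAt ℝ F (f x) ∧ ∀ᶠ p in 𝓝 x, h p = F (f p) := by
  set φ := extChartAt (𝓡 n) x with hφ
  set g : 𝔼 → ℝ := f ∘ φ.symm with hg
  have h0 : fderiv ℝ g (φ x) ≠ 0 := fderiv_comp_extChartAt_symm_ne_zero hf hx
  have hxt : φ x ∈ φ.target := mem_extChartAt_target x
  have hgc : ContDiffAt ℝ ω g (φ x) := contDiffAt_comp_extChartAt_symm x hxt (hf _)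
  have hga : g (φ x) = f x := congrArg f (extChartAt_to_inv x)
  obtain ⟨W, hW, hWC⟩ := eventually_exists_isPreconnected_fibre
    (hgc.hasStrictFDerivAt (by simp)) h0 ((isOpen_extChartAt_target x).mem_nhds hxt)
  obtain ⟨σ, hσ, hσx, hgσ⟩ := exists_analyticAt_section hgc.analyticAt h0
  rw [hga] at hσ hσx hgσ
  have hfc : ContinuousAt f x := hf.continuous.continuousAt
  -- `F` is `h` read along the section `σ`. A point `p` near `x` and the point of the section with
  -- the same value lie on one slice, hence on one leaf.
  refine ⟨(h ∘ φ.symm) ∘ σ, ?_, ?_⟩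
  · refine AnalyticAt.comp ?_ hσ
    rw [hσx]
    exact (contDiffAt_comp_extChartAt_symm x hxt (hh _)).analyticAt
  · have hσW : ∀ᶠ p in 𝓝 x, σ (f p) ∈ W := by
      refine (ContinuousAt.comp (f := f) hσ.continuousAt hfc).eventually ?_
      rw [Function.comp_apply, hσx]
      exact hW
    filter_upwards [hσW, hfc.eventually hgσ, continuousAt_extChartAt (I := 𝓡 n) x hW,
      extChartAt_source_mem_nhds (I := 𝓡 n) x] with p hp1 hp2 hp3 hp4
    have hgp : g (φ p) = f p := congrArg f (φ.left_inv hp4)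
    obtain ⟨C, hCO, hC, hpC, hσC, hCf⟩ := hWC (φ p) hp3 (σ (f p)) hp1 (hgp.trans hp2.symm)
    rw [hgp] at hCf
    have hC' : IsPreconnected (φ.symm '' C) :=
      hC.image _ ((continuousOn_extChartAt_symm x).mono hCO)
    have hsub := hC'.subset_connectedComponentIn (x := p) (F := f ⁻¹' {f p})
      ⟨φ p, hpC, φ.left_inv hp4⟩ (by rintro _ ⟨w, hw, rfl⟩; exact hCf hw)
    exact (hconst p _ (hsub ⟨_, hσC, rfl⟩)).symm

variable [RiemannianBundle (fun x : M ↦ TangentSpace (𝓡 n) x)]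
  [IsContMDiffRiemannianBundle (𝓡 n) ω (EuclideanSpace ℝ (Fin n))
        (fun x : M ↦ TangentSpace (𝓡 n) x)]

/-- An equilibrium function is isoparametric on the components of its regular set. -/
theorem IsEquilibrium.isIsoparametricOn {f : M → ℝ} (hf : IsEquilibrium (n := n) f) (x : M) :
    IsIsoparametricOn (n := n) f (connectedComponentIn (criticalSet (n := n) f)ᶜ x) := by
  obtain ⟨hfω, hleaf⟩ := hf
  -- Local connectedness makes the components of the open regular set open.
  have : LocallyConnectedSpace M := ChartedSpace.locallyConnectedSpace 𝔼 M
  have key : ∀ h : M → ℝ, ContMDiff (𝓡 n) 𝓘(ℝ, ℝ) ω h →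
      (∀ p, ∀ q ∈ connectedComponentIn (f ⁻¹' {f p}) p, h q = h p) →
      ∃ F : ℝ → ℝ, AnalyticOnNhd ℝ F (f '' connectedComponentIn (criticalSet (n := n) f)ᶜ x) ∧
        ∀ p ∈ connectedComponentIn (criticalSet (n := n) f)ᶜ x, h p = F (f p) := by
    intro h hh hconst
    have hreg : ∀ p ∈ connectedComponentIn (criticalSet (n := n) f)ᶜ x,
      p ∉ criticalSet (n := n) f := fun p hp ↦ connectedComponentIn_subset _ _ hp
    exact exists_analyticOnNhd_of_locally (isClosed_criticalSet hfω).isOpen_compl.connectedComponentIn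
      isPreconnected_connectedComponentIn hfω.continuous.continuousOn
      (fun p hp ↦ nhds_le_map_nhds_of_notMem_criticalSet hfω (hreg p hp))
      (fun p hp ↦ exists_analyticAt_of_constant_on_leaves hfω hh hconst (hreg p hp))
  obtain ⟨F, hF, hFf⟩ := key _ (contMDiff_gradSq hfω) fun p q hq ↦ (hleaf p q hq).1
  obtain ⟨G, hG, hGf⟩ := key _ (contMDiff_laplacian hfω) fun p q hq ↦ (hleaf p q hq).2
  exact ⟨(hfω.of_le le_top).contMDiffOn, F, G, fun s hs ↦ (hF s hs).contDiffAt.contDiffWithinAt,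
    fun s hs ↦ (hG s hs).contDiffAt.contDiffWithinAt, fun p hp ↦ ⟨hFf p hp, hGf p hp⟩⟩

end Isoparametric

/-! ### Gradient and Laplacian on Euclidean space -/

section Euclidean

variable {n : ℕ}

local notation "𝔼" => EuclideanSpace ℝ (Fin n)

theorem extChartAt_euclidean (x : 𝔼) : extChartAt (𝓡 n) x = PartialEquiv.refl 𝔼 :=
  extChartAt_model_space_eq_id ℝ x

theorem coordVector_euclidean (x y : 𝔼) (i : Fin n) :
    (coordVector (n := n) x i y : 𝔼) = EuclideanSpace.single i (1 : ℝ) := by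
  have h := mfderiv_extChartAt_comp_mfderiv_symm (n := n) (M := 𝔼) x (y := y)
    (by rw [extChartAt_euclidean]; trivial) (EuclideanSpace.single i (1 : ℝ))
  have h2 : ∀ z, mfderiv (𝓡 n) 𝓘(ℝ, 𝔼) (extChartAt (𝓡 n) x) z = ContinuousLinearMap.id ℝ 𝔼 :=
    fun z ↦ by
      rw [extChartAt_euclidean]
      exact mfderiv_id
  rw [h2] at h
  exact h

theorem metricMatrix_euclidean (x y : 𝔼) : metricMatrix (n := n) x y = 1 := by
  ext i j
  have h : metricMatrix (n := n) x y i j =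
      @inner ℝ 𝔼 _ (coordVector (n := n) x i y) (coordVector (n := n) x j y) := rfl
  rw [h, coordVector_euclidean, coordVector_euclidean]
  simp [Matrix.one_apply, EuclideanSpace.inner_single_left]

theorem coordField_riemGradient_euclidean {f : 𝔼 → ℝ} (hf : ContDiff ℝ ω f) (x y : 𝔼) (i : Fin n) :
    coordField (n := n) (riemGradient f) x y i = fderiv ℝ f y (EuclideanSpace.single i 1) := by
  have h := metricMatrix_mulVec_coordField (n := n) (f := f) x (y := y)
    (by rw [extChartAt_euclidean]; trivial) hf.contMDiff.contMDiffAt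
  rw [metricMatrix_euclidean, Matrix.one_mulVec, extChartAt_euclidean] at h
  exact congrFun h i

theorem gradSq_euclidean {f : 𝔼 → ℝ} (hf : ContDiff ℝ ω f) (p : 𝔼) :
    gradSq (n := n) f p = ∑ i, fderiv ℝ f p (EuclideanSpace.single i 1) ^ 2 := by
  have h2 : coordField (n := n) (riemGradient f) p p = riemGradient (n := n) f p := by
    have h2 : ∀ z, mfderiv (𝓡 n) 𝓘(ℝ, 𝔼) (extChartAt (𝓡 n) p) z = ContinuousLinearMap.id ℝ 𝔼 :=
      fun z ↦ by
        rw [extChartAt_euclidean]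
        exact mfderiv_id
    rw [coordField, h2, extChartAt_euclidean]
    rfl
  rw [gradSq_eq, ← h2, mfderiv_eq_fderiv]
  refine (sum_smul_map_single (fderiv ℝ f p).toLinearMap _).symm.trans ?_
  refine Finset.sum_congr rfl fun i _ ↦ ?_
  rw [coordField_riemGradient_euclidean hf, sq]
  rfl

theorem laplacian_euclidean {f : 𝔼 → ℝ} (hf : ContDiff ℝ ω f) (p : 𝔼) :
    laplacian (n := n) f p = ∑ i, fderiv ℝ (fun y ↦ fderiv ℝ f y (EuclideanSpace.single i 1)) p
      (EuclideanSpace.single i 1) := by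
  have hv : ∀ y, volDensity (n := n) p y = 1 := fun y ↦ by
    simp [volDensity, metricMatrix_euclidean]
  simp only [laplacian, divergence, hv, coordField_riemGradient_euclidean hf]
  rw [extChartAt_euclidean]
  simp

end Euclidean

/-! ### The function `cos √s` and radial functions -/

/-- There is a real-analytic function on the line which equals `cos √s` for `s ≥ 0`. -/
theorem exists_contDiff_sq_eq_cos :
    ∃ c : ℝ → ℝ, ContDiff ℝ ω c ∧ ∀ r : ℝ, c (r ^ 2) = Real.cos r := by
  set a : ℕ → ℝ := fun k ↦ (-1) ^ k / (2 * k).factorial with ha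
  have hrad : (FormalMultilinearSeries.ofScalars ℝ a).radius = ⊤ := by
    refine FormalMultilinearSeries.radius_eq_top_of_summable_norm _ fun r ↦ ?_
    -- The norms of the terms `(-1)ᵏ rᵏ / (2k)!` are those of the series of `cosh √r`, so the radius
    -- is infinite.
    have h := (Real.hasSum_cosh (√r)).summable
    refine h.congr fun k ↦ ?_
    rw [FormalMultilinearSeries.ofScalars_norm, pow_mul, Real.sq_sqrt r.coe_nonneg]
    simp [ha, div_eq_inv_mul]
  have hb := (FormalMultilinearSeries.ofScalars ℝ a).hasFPowerSeriesOnBall (by simp [hrad])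
  refine ⟨(FormalMultilinearSeries.ofScalars ℝ a).sum, ?_, fun r ↦ ?_⟩
  · rw [contDiff_omega_iff_analyticOnNhd]
    refine hb.analyticOnNhd.mono ?_
    simp [hrad]
  · refine (FormalMultilinearSeries.ofScalars_sum_eq a (r ^ 2)).trans ?_
    rw [← (Real.hasSum_cos r).tsum_eq]
    refine tsum_congr fun k ↦ ?_
    rw [ha, smul_eq_mul, pow_mul]
    ring

theorem contDiff_omega_deriv {c : ℝ → ℝ} (hc : ContDiff ℝ ω c) : ContDiff ℝ ω (deriv c) :=
  contDiff_omega_iff_analyticOnNhd.2 (contDiff_omega_iff_analyticOnNhd.1 hc).deriv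

section Radial

variable {n : ℕ} {c : ℝ → ℝ}

local notation "𝔼" => EuclideanSpace ℝ (Fin n)

theorem fderiv_comp_norm_sq {y : 𝔼} (hc : DifferentiableAt ℝ c (‖y‖ ^ 2)) (i : Fin n) :
    fderiv ℝ (fun w : 𝔼 ↦ c (‖w‖ ^ 2)) y (EuclideanSpace.single i 1) =
      deriv c (‖y‖ ^ 2) * (2 * y i) := by
  have h := hc.hasDerivAt.comp_hasFDerivAt y (hasStrictFDerivAt_norm_sq y).hasFDerivAt
  have h2 := congrArg (fun L : 𝔼 →L[ℝ] ℝ ↦ L (EuclideanSpace.single i 1)) h.fderiv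
  refine h2.trans ?_
  simp [EuclideanSpace.inner_single_right]

theorem gradSq_comp_norm_sq (hc : ContDiff ℝ ω c) (p : 𝔼) :
    gradSq (n := n) (fun w : 𝔼 ↦ c (‖w‖ ^ 2)) p = 4 * ‖p‖ ^ 2 * deriv c (‖p‖ ^ 2) ^ 2 := by
  rw [gradSq_euclidean (f := fun w : 𝔼 ↦ c (‖w‖ ^ 2)) (hc.comp (contDiff_norm_sq ℝ))]
  simp only [fderiv_comp_norm_sq (hc.differentiable (by simp) _)]
  conv_rhs => rw [EuclideanSpace.real_norm_sq_eq p]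
  rw [Finset.mul_sum, Finset.sum_mul]
  refine Finset.sum_congr rfl fun i _ ↦ ?_
  rw [EuclideanSpace.real_norm_sq_eq p]
  ring

theorem laplacian_comp_norm_sq (hc : ContDiff ℝ ω c) (p : 𝔼) :
    laplacian (n := n) (fun w : 𝔼 ↦ c (‖w‖ ^ 2)) p =
      4 * ‖p‖ ^ 2 * deriv (deriv c) (‖p‖ ^ 2) + 2 * n * deriv c (‖p‖ ^ 2) := by
  have hc' := contDiff_omega_deriv hc
  rw [laplacian_euclidean (f := fun w : 𝔼 ↦ c (‖w‖ ^ 2)) (hc.comp (contDiff_norm_sq ℝ))]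
  simp only [fderiv_comp_norm_sq (hc.differentiable (by simp) _)]
  have h : ∀ i : Fin n, fderiv ℝ (fun y : 𝔼 ↦ deriv c (‖y‖ ^ 2) * (2 * y i)) p
      (EuclideanSpace.single i 1) =
      4 * p i ^ 2 * deriv (deriv c) (‖p‖ ^ 2) + 2 * deriv c (‖p‖ ^ 2) := by
    intro i
    have hd : DifferentiableAt ℝ (fun y : 𝔼 ↦ deriv c (‖y‖ ^ 2)) p :=
      (hc'.comp (contDiff_norm_sq ℝ)).differentiable (by simp) p
    have hl : HasFDerivAt (fun y : 𝔼 ↦ 2 * y i) ((2 : ℝ) • (EuclideanSpace.proj i : 𝔼 →L[ℝ] ℝ)) p :=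
      (EuclideanSpace.proj i : 𝔼 →L[ℝ] ℝ).hasFDerivAt.const_mul 2
    refine (congrArg (fun L : 𝔼 →L[ℝ] ℝ ↦ L (EuclideanSpace.single i 1))
      (hd.hasFDerivAt.mul hl).fderiv).trans ?_
    simp only [add_apply, smul_apply, smul_eq_mul,
      fderiv_comp_norm_sq (hc'.differentiable (by simp) _)]
    simp
    ring
  simp only [h, Finset.sum_add_distrib]
  conv_rhs => rw [EuclideanSpace.real_norm_sq_eq p]
  rw [Finset.mul_sum, Finset.sum_mul, EuclideanSpace.real_norm_sq_eq p]
  simp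
  ring

end Radial

/-! ### The example `cos √(x² + y²)` -/

/-- On a nontrivial interval of constancy two differentiations give `sin = 0` and `cos = 0`, against
`sin² + cos² = 1`. -/
theorem subsingleton_of_cos_const {S : Set ℝ} (hS : IsPreconnected S) {k : ℝ}
    (hk : ∀ r ∈ S, Real.cos r = k) : S.Subsingleton := by
  have key : ∀ a ∈ S, ∀ b ∈ S, ¬ a < b := by
    intro a ha b hb hab
    obtain ⟨m, hm⟩ := exists_between hab
    have h1 : ∀ r ∈ Ioo a b, Real.cos r = k := fun r hr ↦
      hk r (hS.ordConnected.out ha hb (Ioo_subset_Icc_self hr))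
    have h2 : ∀ r ∈ Ioo a b, Real.sin r = 0 := by
      intro r hr
      have : Real.cos =ᶠ[𝓝 r] fun _ ↦ k := by
        filter_upwards [isOpen_Ioo.mem_nhds hr] with t ht using h1 t ht
      simpa using this.deriv_eq
    have h3 : Real.cos m = 0 := by
      have : Real.sin =ᶠ[𝓝 m] fun _ ↦ 0 := by
        filter_upwards [isOpen_Ioo.mem_nhds hm] with t ht using h2 t ht
      simpa using this.deriv_eq
    have := Real.sin_sq_add_cos_sq m
    rw [h2 m hm, h3] at this
    norm_num at this
  exact fun a ha b hb ↦ le_antisymm (not_lt.1 (key b hb a ha)) (not_lt.1 (key a ha b hb))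

theorem cosRadius_eq_cos_norm (p : EuclideanSpace ℝ (Fin 2)) : cosRadius p = Real.cos ‖p‖ := by
  rw [cosRadius, EuclideanSpace.norm_eq, Fin.sum_univ_two]
  simp

/-- The norm maps a leaf to a connected set of reals on which `cos` is constant, hence to a single
point. -/
theorem norm_eq_of_mem_leaf_cosRadius {p q : EuclideanSpace ℝ (Fin 2)}
    (hq : q ∈ connectedComponentIn (cosRadius ⁻¹' {cosRadius p}) p) : ‖q‖ = ‖p‖ := by
  have hp : p ∈ connectedComponentIn (cosRadius ⁻¹' {cosRadius p}) p :=
    mem_connectedComponentIn rfl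
  refine subsingleton_of_cos_const (k := cosRadius p)
    (isPreconnected_connectedComponentIn.image norm continuous_norm.continuousOn) ?_
    (mem_image_of_mem _ hq) (mem_image_of_mem _ hp)
  rintro _ ⟨w, hw, rfl⟩
  rw [← cosRadius_eq_cos_norm]
  have hw' : w ∈ cosRadius ⁻¹' {cosRadius p} := connectedComponentIn_subset _ _ hw
  exact hw'

theorem cosRadius_eq_comp_norm_sq {c : ℝ → ℝ} (hcos : ∀ r : ℝ, c (r ^ 2) = Real.cos r) :
    cosRadius = fun p ↦ c (‖p‖ ^ 2) :=
  funext fun p ↦ (cosRadius_eq_cos_norm p).trans (hcos _).symm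

theorem isEquilibrium_cosRadius : IsEquilibrium (n := 2) cosRadius := by
  obtain ⟨c, hc, hcos⟩ := exists_contDiff_sq_eq_cos
  have hf := cosRadius_eq_comp_norm_sq hcos
  refine ⟨?_, fun p q hq ↦ ?_⟩
  · rw [hf]
    exact (hc.comp (contDiff_norm_sq ℝ)).contMDiff
  · have h := norm_eq_of_mem_leaf_cosRadius hq
    rw [hf, gradSq_comp_norm_sq hc, gradSq_comp_norm_sq hc, laplacian_comp_norm_sq hc,
      laplacian_comp_norm_sq hc, h]
    exact ⟨rfl, rfl⟩

/-- The Laplacian of `cos √(x² + y²)` takes different values at the origin and on the circle of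
radius `2π`, where the function itself takes the same value. -/
theorem not_exists_laplacian_cosRadius_eq :
    ¬ ∃ G : ℝ → ℝ, ∀ p, laplacian (n := 2) cosRadius p = G (cosRadius p) := by
  rintro ⟨G, hG⟩
  obtain ⟨c, hc, hcos⟩ := exists_contDiff_sq_eq_cos
  have hf := cosRadius_eq_comp_norm_sq hcos
  have hc' := contDiff_omega_deriv hc
  have hsq : ∀ r : ℝ, HasDerivAt (fun t : ℝ ↦ t ^ 2) (2 * r) r := fun r ↦ by
    simpa using hasDerivAt_pow 2 r
  have h1 : ∀ r : ℝ, deriv c (r ^ 2) * (2 * r) = -Real.sin r := by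
    intro r
    have h := ((hc.differentiable (by simp) (r ^ 2)).hasDerivAt).comp r (hsq r)
    rw [show c ∘ (fun t : ℝ ↦ t ^ 2) = Real.cos from funext hcos] at h
    exact h.unique (Real.hasDerivAt_cos r)
  -- Differentiating `h1` once more gives the second-order term of the Laplacian without dividing by
  -- `r`, so `r = 0` is included.
  have h2 : ∀ r : ℝ, 4 * r ^ 2 * deriv (deriv c) (r ^ 2) + 2 * deriv c (r ^ 2) = -Real.cos r := by
    intro r
    have h := (((hc'.differentiable (by simp) (r ^ 2)).hasDerivAt).comp r (hsq r)).mul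
      ((hasDerivAt_id r).const_mul 2)
    have h' := h.congr_of_eventuallyEq (f₁ := fun t ↦ -Real.sin t)
      (Eventually.of_forall fun t ↦ (h1 t).symm)
    rw [← h'.unique (Real.hasDerivAt_sin r).neg]
    simp
    ring
  have hlap : ∀ p : EuclideanSpace ℝ (Fin 2), -Real.cos ‖p‖ + 2 * deriv c (‖p‖ ^ 2) =
      G (Real.cos ‖p‖) := by
    intro p
    rw [← cosRadius_eq_cos_norm, ← hG p, cosRadius_eq_cos_norm, hf, laplacian_comp_norm_sq hc,
      ← h2]
    push_cast
    ring
  have hπ := Real.pi_pos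
  have e1 := hlap 0
  -- At radius `2π` the cosine is again `1`, but `c'` vanishes there, while `2c'(0) = -1` at the
  -- origin.
  have e2 := hlap (EuclideanSpace.single 0 (2 * Real.pi))
  have hn : ‖(EuclideanSpace.single 0 (2 * Real.pi) : EuclideanSpace ℝ (Fin 2))‖ = 2 * Real.pi := by
    rw [PiLp.norm_single, Real.norm_of_nonneg (by positivity)]
  have h3 := h1 (2 * Real.pi)
  have h4 := h2 0
  rw [hn, Real.cos_two_pi] at e2
  rw [norm_zero, Real.cos_zero] at e1
  rw [Real.sin_two_pi, neg_zero] at h3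
  rw [Real.cos_zero] at h4
  have h5 : deriv c ((2 * Real.pi) ^ 2) = 0 := by
    rcases mul_eq_zero.1 h3 with h | h
    · exact h
    · linarith
  rw [h5] at e2
  linarith

end Isopar

end

theorem mainTheorem1 :
    -- every equilibrium function is isoparametric on each component of `M \ C(f)`
    (∀ (n : ℕ) (M : Type*) [TopologicalSpace M] [ChartedSpace (EuclideanSpace ℝ (Fin n)) M]
      [IsManifold (𝓡 n) ω M]
      [RiemannianBundle (fun x : M ↦ TangentSpace (𝓡 n) x)]
      [IsContMDiffRiemannianBundle (𝓡 n) ω (EuclideanSpace ℝ (Fin n))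
        (fun x : M ↦ TangentSpace (𝓡 n) x)]
      (f : M → ℝ), Isopar.IsEquilibrium (n := n) f →
        ∀ x ∉ Isopar.criticalSet (n := n) f,
          Isopar.IsIsoparametricOn (n := n) f
            (connectedComponentIn (Isopar.criticalSet (n := n) f)ᶜ x)) ∧
    -- on the Euclidean plane, `cos √(x² + y²)` is an equilibrium function whose Laplacian is not
    -- globally a function of it; in particular it is not globally isoparametric
    (Isopar.IsEquilibrium (n := 2) Isopar.cosRadius ∧
      (¬ ∃ G : ℝ → ℝ, ∀ p, Isopar.laplacian (n := 2) Isopar.cosRadius p = G (Isopar.cosRadius p)) ∧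
      ¬ Isopar.IsIsoparametricOn (n := 2) Isopar.cosRadius Set.univ) := by 
  refine ⟨fun n M _ _ _ _ _ f hf x _ ↦ hf.isIsoparametricOn x, Isopar.isEquilibrium_cosRadius,
    Isopar.not_exists_laplacian_cosRadius_eq, ?_⟩
  rintro ⟨-, F, G, -, -, hG⟩
  exact Isopar.not_exists_laplacian_cosRadius_eq ⟨G, fun p ↦ (hG p (Set.mem_univ p)).2⟩
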